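/- An edge-ordered graph is a finite simple graph together with a total order on its edge set. A copy of an edge-ordered graph $F$ in an edge-ordered graph $H$ is given by an injective map $V(F)\to V(H)$ that sends edges to edges and preserves the order of the edges; a perfect $F$-tiling in $H$ is a collection of pairwise vertex-disjoint copies of $F$ in $H$ that together cover all vertices of $H$. An edge-ordered graph $F$ on $f$ vertices is tileable if there is a positive integer $t$ divisible by $f$ such that $K_t$, under every total ordering of its edges, contains a perfect $F$-tiling. For $n\ge 3$, a monotone cycle of length $n$ is an edge-ordered cycle with vertices $u_1,\dots,u_n$ and edges ordered as $u_1u_2<u_2u_3<\dots<u_{n-1}u_n<u_nu_1$. Proposition. For every odd $n\ge 3$, every monotone cycle of length $n$ is tileable. -/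

import Mathlib

/-- An edge-ordered graph on the vertex set `V`: a simple graph together with a total order on its
set of edges. -/
structure EdgeOrderedGraph (V : Type*) where
  /-- the underlying graph -/
  graph : SimpleGraph V
  /-- the total order on the edges -/
  edgeOrder : LinearOrder graph.edgeSet

namespace EdgeOrderedGraph

/-- `F.Less e₁ e₂`: both `e₁` and `e₂` are edges of `F`, and `e₁` is smaller than `e₂` in the total
order of the edges of `F`. -/
def Less {V : Type*} (F : EdgeOrderedGraph V) (e₁ e₂ : Sym2 V) : Prop :=
  ∃ (h₁ : e₁ ∈ F.graph.edgeSet) (h₂ : e₂ ∈ F.graph.edgeSet), F.edgeOrder.lt ⟨e₁, h₁⟩ ⟨e₂, h₂⟩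

/-- An embedding of `F` into `H` (that is, a copy of `F` in `H`): an injective map on the vertices
(not necessarily induced) that sends edges to edges and preserves the order of the edges. -/
structure Embedding {V W : Type*} (F : EdgeOrderedGraph V) (H : EdgeOrderedGraph W) extends
    SimpleGraph.Copy F.graph H.graph where
  map_less : ∀ e₁ e₂ : Sym2 V, F.Less e₁ e₂ → H.Less (e₁.map toHom) (e₂.map toHom)

/-- `H` has a perfect `F`-tiling: a collection of pairwise vertex-disjoint copies of `F` in `H`
that covers all vertices of `H`. -/
def HasPerfectTiling {V W : Type*} (F : EdgeOrderedGraph V) (H : EdgeOrderedGraph W) : Prop :=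
  ∃ T : Set (F.Embedding H),
    T.PairwiseDisjoint (fun φ => Set.range φ.toHom) ∧ (⋃ φ ∈ T, Set.range φ.toHom) = Set.univ

/-- `F` is tileable: there is a positive `t` divisible by the number of vertices of `F` such that
every edge-ordering of the complete graph `K_t` contains a perfect `F`-tiling. -/
def Tileable {V : Type*} [Fintype V] (F : EdgeOrderedGraph V) : Prop :=
  ∃ t : ℕ, 0 < t ∧ Fintype.card V ∣ t ∧
    ∀ o : LinearOrder (⊤ : SimpleGraph (Fin t)).edgeSet, F.HasPerfectTiling ⟨⊤, o⟩

/-- `F` is a monotone cycle of length `n`: its vertices can be enumerated (without repetition) as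
`u 0, …, u (n - 1)` so that the underlying graph of `F` is the cycle through them in this cyclic
order, and the edges satisfy
`u 0 u 1 < u 1 u 2 < ⋯ < u (n - 2) u (n - 1) < u (n - 1) u 0`.
Here `finRotate n i` is the cyclic successor of `i`. -/
def IsMonotoneCycle {V : Type*} (F : EdgeOrderedGraph V) (n : ℕ) : Prop :=
  3 ≤ n ∧ ∃ u : SimpleGraph.cycleGraph n ≃g F.graph, ∀ i j : Fin n, i < j →
    F.Less s(u i, u (finRotate n i)) s(u j, u (finRotate n j))

end EdgeOrderedGraph

/-!
In a cyclic sequence of vertices whose edges increase at every vertex except one, the edges form a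
monotone cycle. Let `A` be a large set of vertices on which, by Ramsey's theorem, all comparisons
inside triangles are the same, and split `A` into a lower half `L` and an upper half `U`. Suitably
sorted, `L` and `U` give alternating paths along which the edges increase. Such a path is closed up
to an odd cycle by a vertex `x` from which all pairs `l ∈ L`, `u ∈ U` look alike, and at `x` and
its two neighbours the edges compare as in the triangle `x l u`. Going around that triangle
backwards reverses all three comparisons, so in one of the two directions at least two of them are
increases, which is all that is needed.

Consequently every set of `n` vertices of `A` spans a monotone cycle, and every other vertex `x`
does so with `n - 1` vertices chosen from any large part of `A`, again by Ramsey's theorem. A greedy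
removal of monotone cycles outside `A` leaves few vertices, each of which is absorbed by `A`, and
the rest of `A` is divided arbitrarily.
-/

open Finset

universe u

section Ramsey

variable {α : Type u} [LinearOrder α] {κ : Type*} {r : ℕ}

/-- All increasing `r`-tuples from `T` have the same colour under `c`. The `r`-element subsets of a
linear order are encoded as strictly increasing maps from `Fin r`, on which alone `c` matters. -/
def IsMonochromatic (c : (Fin r → α) → κ) (T : Finset α) : Prop :=
  ∃ k, ∀ u : Fin r → α, StrictMono u → (∀ i, u i ∈ T) → c u = k

theorem exists_color_eq_head_insert {c : (Fin (r + 1) → α) → κ} {S T : Finset α} {x : α}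
    {f : α → κ} (hTS : T ⊆ S) (hxS : ∀ a ∈ S, x < a)
    (hS : IsMonochromatic (fun u : Fin r → α => c (Fin.cons x u)) S)
    (hf : ∀ u : Fin (r + 1) → α, StrictMono u → (∀ i, u i ∈ T) → c u = f (u 0)) :
    ∃ f : α → κ,
      ∀ u : Fin (r + 1) → α, StrictMono u → (∀ i, u i ∈ insert x T) → c u = f (u 0) := by
  obtain ⟨k, hk⟩ := hS
  refine ⟨Function.update f x k, fun u hu huT => ?_⟩
  have mem_of_lt : ∀ i, x < u i → u i ∈ T := fun i hi =>
    (mem_insert.mp (huT i)).resolve_left hi.ne'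
  rcases mem_insert.mp (huT 0) with h | h
  · rw [h, Function.update_self, ← Fin.cons_self_tail u, h]
    exact hk _ (hu.comp Fin.strictMono_succ) fun i =>
      hTS (mem_of_lt _ (h ▸ hu i.succ_pos))
  · rw [Function.update_of_ne (hxS _ (hTS h)).ne']
    exact hf u hu fun i => mem_of_lt i ((hxS _ (hTS h)).trans_le (hu.monotone (Fin.zero_le i)))

theorem exists_color_eq_head [Nonempty κ]
    (ramsey : ∀ m : ℕ, ∃ N : ℕ, ∀ (α : Type u) [LinearOrder α] (S : Finset α), N ≤ #S →
      ∀ c : (Fin r → α) → κ, ∃ T ⊆ S, #T = m ∧ IsMonochromatic c T) (m : ℕ) :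
    ∃ N : ℕ, ∀ (α : Type u) [LinearOrder α] (S : Finset α), N ≤ #S →
      ∀ c : (Fin (r + 1) → α) → κ, ∃ T ⊆ S, #T = m ∧ ∃ f : α → κ,
        ∀ u : Fin (r + 1) → α, StrictMono u → (∀ i, u i ∈ T) → c u = f (u 0) := by
  induction m with
  | zero =>
    exact ⟨0, fun α _ S _ c => ⟨∅, empty_subset S, card_empty, fun _ => Classical.arbitrary κ,
      fun u _ hu => absurd (hu 0) (notMem_empty _)⟩⟩
  | succ m ih =>
    obtain ⟨N, hN⟩ := ih
    obtain ⟨N', hN'⟩ := ramsey N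
    refine ⟨N' + 1, fun α _ S hS c => ?_⟩
    have hne : S.Nonempty := card_pos.mp (by lia)
    let x := S.min' hne
    have hx : x ∈ S := S.min'_mem hne
    obtain ⟨S', hS', hcard, hmono⟩ := hN' α (S.erase x) (by rw [card_erase_of_mem hx]; lia)
      fun u => c (Fin.cons x u)
    obtain ⟨T, hT, rfl, f, hf⟩ := hN α S' hcard.ge c
    have hlt : ∀ a ∈ S', x < a := fun a ha => S.min'_lt_of_mem_erase_min' hne (hS' ha)
    exact ⟨insert x T, insert_subset hx ((hT.trans hS').trans (erase_subset _ _)),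
      card_insert_of_notMem fun h => (hlt x (hT h)).false,
      exists_color_eq_head_insert hT hlt hmono hf⟩

theorem exists_isMonochromatic (κ : Type*) [Finite κ] [Nonempty κ] (r m : ℕ) :
    ∃ N : ℕ, ∀ (α : Type u) [LinearOrder α] (S : Finset α), N ≤ #S →
      ∀ c : (Fin r → α) → κ, ∃ T ⊆ S, #T = m ∧ IsMonochromatic c T := by
  classical
  induction r generalizing m with
  | zero =>
    refine ⟨m, fun α _ S hS c => ?_⟩
    obtain ⟨T, hT, hm⟩ := exists_subset_card_eq hS
    exact ⟨T, hT, hm, c Fin.elim0, fun u _ _ => congrArg c (Subsingleton.elim _ _)⟩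
  | succ r ih =>
    have := Fintype.ofFinite κ
    obtain ⟨N, hN⟩ := exists_color_eq_head ih (Fintype.card κ * m)
    refine ⟨N, fun α _ S hS c => ?_⟩
    obtain ⟨T, hTS, hT, f, hf⟩ := hN α S hS c
    obtain ⟨k, -, hk⟩ := exists_le_card_fiber_of_mul_le_card_of_maps_to (s := T) (t := univ)
      (f := f) (n := m) (fun _ _ => mem_univ _) univ_nonempty (by rw [hT, card_univ])
    obtain ⟨T', hT', hm⟩ := exists_subset_card_eq hk
    have hfk : ∀ a ∈ T', a ∈ T ∧ f a = k := fun a ha => mem_filter.mp (hT' ha)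
    exact ⟨T', fun a ha => hTS (hfk a ha).1, hm, k, fun u hu huT =>
      (hf u hu fun i => (hfk _ (huT i)).1).trans (hfk _ (huT 0)).2⟩

end Ramsey

section Tiles

variable {α : Type*} [DecidableEq α] {P : Finset α → Prop} {m N : ℕ}

theorem exists_finpartition_of_sdiff {S B : Finset α} (hB : P B) (hB₀ : B.Nonempty) (hBS : B ⊆ S)
    (h : ∃ Q : Finpartition (S \ B), ∀ C ∈ Q.parts, P C) :
    ∃ Q : Finpartition S, ∀ C ∈ Q.parts, P C := by
  obtain ⟨Q, hQ⟩ := h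
  refine ⟨Q.extend hB₀.ne_empty sdiff_disjoint (sdiff_union_of_subset hBS), fun C hC => ?_⟩
  rcases mem_insert.mp hC with rfl | hC
  exacts [hB, hQ C hC]

theorem exists_finpartition_of_dvd_card {A : Finset α} (hA : ∀ B ⊆ A, #B = m + 1 → P B)
    (hdvd : m + 1 ∣ #A) : ∃ Q : Finpartition A, ∀ B ∈ Q.parts, P B := by
  obtain ⟨q, hq⟩ := hdvd
  induction q generalizing A with
  | zero =>
    obtain rfl := card_eq_zero.mp hq
    exact ⟨.empty _, fun B hB => absurd hB (notMem_empty B)⟩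
  | succ q ih =>
    obtain ⟨B, hBA, hB⟩ := exists_subset_card_eq (s := A) (n := m + 1) (by lia)
    refine exists_finpartition_of_sdiff (hA B hBA hB) (card_pos.mp (by lia)) hBA ?_
    exact ih (fun C hC => hA C (hC.trans sdiff_subset)) (by rw [card_sdiff_of_subset hBA]; lia)

theorem exists_finpartition_union_of_absorbs {L A : Finset α} (hLA : Disjoint L A)
    (hA : ∀ B ⊆ A, #B = m + 1 → P B)
    (hL : ∀ x ∈ L, ∀ T ⊆ A, N ≤ #T → ∃ B ⊆ T, #B = m ∧ P (insert x B))
    (hcard : #L * m + N ≤ #A) (hdvd : m + 1 ∣ #(L ∪ A)) :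
    ∃ Q : Finpartition (L ∪ A), ∀ B ∈ Q.parts, P B := by
  induction L using Finset.induction_on generalizing A with
  | empty => exact exists_finpartition_of_dvd_card (by simpa using hA) hdvd
  | @insert x L hxL ih =>
    rw [disjoint_insert_left] at hLA
    rw [card_insert_of_notMem hxL, Nat.succ_mul] at hcard
    obtain ⟨B, hBA, hBm, hB⟩ := hL x (mem_insert_self x L) A subset_rfl (by lia)
    have hxB : x ∉ B := fun h => hLA.1 (hBA h)
    have hBL : insert x B ⊆ insert x L ∪ A :=
      insert_subset (mem_union_left _ (mem_insert_self x L)) (hBA.trans subset_union_right)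
    have hrest : (insert x L ∪ A) \ insert x B = L ∪ A \ B := by
      rw [union_sdiff_distrib, insert_sdiff_insert, sdiff_insert_of_notMem hLA.1,
        sdiff_eq_self_of_disjoint (disjoint_insert_right.mpr ⟨hxL, hLA.2.mono_right hBA⟩)]
    refine exists_finpartition_of_sdiff hB (insert_nonempty x B) hBL ?_
    have hcard_rest := card_sdiff_of_subset hBL
    rw [card_insert_of_notMem hxB, hBm] at hcard_rest
    rw [hrest] at hcard_rest ⊢
    exact ih (hLA.2.mono_right sdiff_subset) (fun C hC => hA C (hC.trans sdiff_subset))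
      (fun y hy T hT => hL y (mem_insert_of_mem hy) T (hT.trans sdiff_subset))
      (by rw [card_sdiff_of_subset hBA]; lia) (hcard_rest ▸ Nat.dvd_sub hdvd dvd_rfl)

theorem exists_finpartition_union {D A : Finset α} {N' : ℕ} (hDA : Disjoint D A)
    (hP : ∀ B, P B → #B = m + 1) (hA : ∀ B ⊆ A, #B = m + 1 → P B)
    (hD : ∀ T ⊆ D, N' ≤ #T → ∃ B ⊆ T, P B)
    (habs : ∀ x ∈ D, ∀ T ⊆ A, N ≤ #T → ∃ B ⊆ T, #B = m ∧ P (insert x B))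
    (hcard : N' * m + N ≤ #A) (hdvd : m + 1 ∣ #(D ∪ A)) :
    ∃ Q : Finpartition (D ∪ A), ∀ B ∈ Q.parts, P B := by
  induction D using Finset.strongInduction with
  | H D ih =>
    by_cases hlt : #D < N'
    · exact exists_finpartition_union_of_absorbs hDA hA habs
        ((Nat.add_le_add_right (Nat.mul_le_mul_right m hlt.le) N).trans hcard) hdvd
    obtain ⟨B, hBD, hB⟩ := hD D subset_rfl (not_lt.mp hlt)
    have hB₀ : B.Nonempty := card_pos.mp (by rw [hP B hB]; lia)
    have hBDA := hBD.trans (subset_union_left (s₂ := A))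
    have hrest : (D ∪ A) \ B = D \ B ∪ A := by
      rw [union_sdiff_distrib, sdiff_eq_self_of_disjoint (hDA.symm.mono_right hBD)]
    have hcard_rest := card_sdiff_of_subset hBDA
    refine exists_finpartition_of_sdiff hB hB₀ hBDA ?_
    rw [hP B hB] at hcard_rest
    rw [hrest] at hcard_rest ⊢
    exact ih _ (sdiff_ssubset hBD hB₀) (hDA.mono_left sdiff_subset)
      (fun T hT => hD T (hT.trans sdiff_subset)) (fun x hx => habs x (sdiff_subset hx))
      (hcard_rest ▸ Nat.dvd_sub hdvd dvd_rfl)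

end Tiles

section LinearOrders

variable {α : Type*} [LinearOrder α]

theorem exists_enum_of_forall_lt {S : Finset α} {k : ℕ} (hk : #S = k)
    {r : α → α → Prop}
    (hr : (∀ a ∈ S, ∀ b ∈ S, a < b → r a b) ∨ ∀ a ∈ S, ∀ b ∈ S, a < b → r b a) :
    ∃ f : Fin k → α, f.Injective ∧ Set.range f = S ∧ ∀ i j, i < j → r (f i) (f j) := by
  let f := S.orderEmbOfFin hk
  have hf : ∀ i, f i ∈ S := S.orderEmbOfFin_mem hk
  rcases hr with hr | hr
  · exact ⟨f, f.injective, S.range_orderEmbOfFin hk, fun i j hij =>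
      hr _ (hf i) _ (hf j) (f.strictMono hij)⟩
  · exact ⟨f ∘ Fin.rev, f.injective.comp Fin.rev_injective,
      (Fin.rev_surjective.range_comp f).trans (S.range_orderEmbOfFin hk), fun i j hij =>
      hr _ (hf _) _ (hf _) (f.strictMono (Fin.rev_lt_rev.mpr hij))⟩

theorem exists_union_eq_forall_lt {A : Finset α} {k l : ℕ} (hA : #A = k + l) :
    ∃ L U : Finset α, L ∪ U = A ∧ #L = k ∧ #U = l ∧ ∀ a ∈ L, ∀ b ∈ U, a < b := by
  let f := A.orderEmbOfFin hA
  refine ⟨univ.map ((Fin.castAddEmb l).trans f.toEmbedding),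
    univ.map ((Fin.natAddEmb k).trans f.toEmbedding), ?_, by simp, by simp, ?_⟩
  · rw [← map_map, ← map_map, ← map_union, ← map_orderEmbOfFin_univ A hA]
    congr 1
    ext i
    cases i using Fin.addCases <;> simp
  · simp only [mem_map, mem_univ, true_and, forall_exists_index, forall_apply_eq_imp_iff]
    exact fun i j => f.strictMono (Fin.lt_def.mpr (i.2.trans_le (k.le_add_right j)))

end LinearOrders

theorem exists_forall_ne_or_exists_forall_ne_not (c : Fin 3 → Prop) :
    (∃ i₀, ∀ i ≠ i₀, c i) ∨ ∃ i₀, ∀ i ≠ i₀, ¬c i := by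
  simp only [Fin.forall_fin_succ, Fin.exists_fin_succ]
  by_cases h0 : c 0 <;> by_cases h1 : c 1 <;> by_cases h2 : c 2 <;> simp_all

namespace EdgeOrderedGraph

section Cycles

variable {W : Type*} {H : EdgeOrderedGraph W}

theorem Less.trans {e₁ e₂ e₃ : Sym2 W} (h : H.Less e₁ e₂) (h' : H.Less e₂ e₃) :
    H.Less e₁ e₃ :=
  ⟨h.1, h'.2.1, @lt_trans _ H.edgeOrder.toPreorder _ _ _ h.2.2 h'.2.2⟩

theorem Less.irrefl (e : Sym2 W) : ¬H.Less e e := fun h =>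
  @lt_irrefl _ H.edgeOrder.toPreorder _ h.2.2

instance : IsTrans (Sym2 W) H.Less := ⟨fun _ _ _ => Less.trans⟩

theorem less_of_not_less (hH : H.graph = ⊤) {x a b : W} (hxa : x ≠ a) (hxb : x ≠ b) (hab : a ≠ b)
    (h : ¬H.Less s(a, x) s(x, b)) : H.Less s(b, x) s(x, a) := by
  have hax : s(a, x) ∈ H.graph.edgeSet := by simp [hH, hxa.symm]
  have hbx : s(x, b) ∈ H.graph.edgeSet := by simp [hH, hxb]
  have hne : s(a, x) ≠ s(x, b) := by simp [Sym2.eq_swap (a := a), hab, hxa.symm]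
  rw [Sym2.eq_swap (a := b), Sym2.eq_swap (b := a)]
  have hlt := @lt_or_gt_of_ne _ H.edgeOrder ⟨_, hax⟩ ⟨_, hbx⟩ (Subtype.coe_ne_coe.mp hne)
  exact ⟨hbx, hax, hlt.resolve_left fun h' => h ⟨hax, hbx, h'⟩⟩

/-- At the `i`-th vertex of the cyclic sequence of vertices `c`, the edge arriving from the
previous vertex is smaller than the edge leaving to the next one. -/
def IncreasesAt {n : ℕ} [NeZero n] (H : EdgeOrderedGraph W) (c : Fin n → W) (i : Fin n) : Prop :=
  H.Less s(c (i - 1), c i) s(c i, c (i + 1))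

/-- `B` is the vertex set of a monotone cycle of length `n` in `H`, in a rotation-invariant form:
the edges of a cyclic enumeration of `B` increase at every vertex other than the one where the
largest edge is followed by the smallest. -/
def SpansMonotoneCycle (H : EdgeOrderedGraph W) (n : ℕ) [NeZero n] (B : Set W) : Prop :=
  ∃ c : Fin n → W, c.Injective ∧ Set.range c = B ∧ ∃ i₀, ∀ i ≠ i₀, H.IncreasesAt c i

theorem increasesAt_triangle_swap (hH : H.graph = ⊤) {x a b : W} (hxa : x ≠ a) (hxb : x ≠ b)
    (hab : a ≠ b) {i : Fin 3} (h : ¬H.IncreasesAt ![x, a, b] i) :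
    H.IncreasesAt ![x, b, a] (-i) := by
  fin_cases i
  · exact less_of_not_less hH hxb hxa hab.symm h
  · exact less_of_not_less hH hxa.symm hab hxb h
  · exact less_of_not_less hH hab.symm hxb.symm hxa.symm h

/-- The sequence `f 0, g 0, f 1, g 1, …, f (k - 1), g (k - 1)`. -/
def interleave {k : ℕ} (f g : Fin k → W) (i : Fin (k * 2)) : W :=
  ![f, g] i.modNat i.divNat

/-- The cyclic sequence `x, f 0, g 0, f 1, g 1, …, f (k - 1), g (k - 1)`. -/
def zigzag {k : ℕ} (x : W) (f g : Fin k → W) : Fin (k * 2 + 1) → W :=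
  Fin.cons x (interleave f g)

section Zigzag

variable {k : ℕ} {x : W} {f g : Fin k → W}

theorem zigzag_two_mul_add_one (i : Fin k) {j : Fin (k * 2 + 1)} (hj : (j : ℕ) = 2 * i + 1) :
    zigzag x f g j = f i := by
  obtain ⟨j, rfl⟩ := Fin.exists_succ_eq.mpr (show j ≠ 0 by rintro rfl; simp at hj)
  rw [Fin.val_succ, Nat.add_right_cancel_iff] at hj
  have hmod : j.modNat = 0 := Fin.ext (by simp [hj])
  have hdiv : j.divNat = i := Fin.ext (by simp [hj])
  simp only [zigzag, interleave, Fin.cons_succ, hmod, hdiv, Matrix.cons_val_zero]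

theorem zigzag_two_mul_add_two (i : Fin k) {j : Fin (k * 2 + 1)} (hj : (j : ℕ) = 2 * i + 2) :
    zigzag x f g j = g i := by
  obtain ⟨j, rfl⟩ := Fin.exists_succ_eq.mpr (show j ≠ 0 by rintro rfl; simp at hj)
  rw [Fin.val_succ, Nat.add_right_cancel_iff] at hj
  have hmod : j.modNat = 1 := Fin.ext (by simp [hj, Nat.add_mod])
  have hdiv : j.divNat = i := Fin.ext (show (j : ℕ) / 2 = i by lia)
  simp only [zigzag, interleave, Fin.cons_succ, hmod, hdiv, Matrix.cons_val_one,
    Matrix.cons_val_zero]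

theorem range_interleave : Set.range (interleave f g) = Set.range f ∪ Set.range g := by
  change Set.range ((fun p : Fin k × Fin 2 => ![f, g] p.2 p.1) ∘ finProdFinEquiv.symm) = _
  rw [finProdFinEquiv.symm.surjective.range_comp]
  ext w
  simp [Prod.exists, exists_or]

theorem interleave_injective (hf : f.Injective) (hg : g.Injective) (hfg : ∀ i j, f i ≠ g j) :
    (interleave f g).Injective := by
  suffices h : (fun p : Fin k × Fin 2 => ![f, g] p.2 p.1).Injective from
    h.comp finProdFinEquiv.symm.injective
  rintro ⟨i, s⟩ ⟨j, t⟩ h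
  fin_cases s <;> fin_cases t
  · exact congrArg (·, 0) (hf h)
  · exact absurd h (hfg i j)
  · exact absurd h.symm (hfg j i)
  · exact congrArg (·, 1) (hg h)

theorem increasesAt_zigzag_of_one_lt {i : Fin (k * 2 + 1)}
    (hf : ∀ l i j, i < j → H.Less s(f i, g l) s(g l, f j))
    (hg : ∀ l i j, i < j → H.Less s(g i, f l) s(f l, g j)) (hi : 1 < (i : ℕ))
    (hik : (i : ℕ) < k * 2) : H.IncreasesAt (zigzag x f g) i := by
  have hsub : ((i - 1 : Fin _) : ℕ) = i - 1 :=
    Fin.val_sub_one_of_ne_zero (by rintro h; simp [h] at hi)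
  have hadd : ((i + 1 : Fin _) : ℕ) = i + 1 := Fin.val_add_one_of_lt hik
  unfold IncreasesAt
  obtain ⟨t, ht | ht⟩ := (i : ℕ).even_or_odd'
  · obtain ⟨t, rfl⟩ := Nat.exists_eq_succ_of_ne_zero (show t ≠ 0 by lia)
    rw [zigzag_two_mul_add_one ⟨t, by lia⟩ (by lia),
      zigzag_two_mul_add_two ⟨t, by lia⟩ (by lia),
      zigzag_two_mul_add_one ⟨t + 1, by lia⟩ (by lia)]
    exact hf _ _ _ (by simp)
  · obtain ⟨t, rfl⟩ := Nat.exists_eq_succ_of_ne_zero (show t ≠ 0 by lia)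
    rw [zigzag_two_mul_add_two ⟨t, by lia⟩ (by lia),
      zigzag_two_mul_add_one ⟨t + 1, by lia⟩ (by lia),
      zigzag_two_mul_add_two ⟨t + 1, by lia⟩ (by lia)]
    exact hg _ _ _ (by simp)

theorem increasesAt_zigzag_of_triangle {f g : Fin (k + 1) → W} {i : Fin 3}
    (h : ∀ a b, H.IncreasesAt ![x, f a, g b] i) :
    H.IncreasesAt (zigzag x f g) (![0, 1, Fin.last _] i) := by
  have h_first : zigzag x f g 1 = f 0 := zigzag_two_mul_add_one 0 rfl
  have h_second : zigzag x f g (1 + 1) = g 0 :=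
    zigzag_two_mul_add_two 0 (Fin.val_add_one_of_lt (show 1 < (k + 1) * 2 by lia))
  have h_last : zigzag x f g (Fin.last _) = g (Fin.last k) :=
    zigzag_two_mul_add_two (Fin.last k) (by simp only [Fin.val_last]; lia)
  unfold IncreasesAt
  fin_cases i
  · change H.Less s(zigzag x f g (0 - 1), x) s(x, zigzag x f g (0 + 1))
    rw [zero_add, h_first, sub_eq_of_eq_add (Fin.last_add_one _).symm, h_last]
    exact h 0 (Fin.last k)
  · change H.Less s(zigzag x f g (1 - 1), zigzag x f g 1) s(zigzag x f g 1, zigzag x f g (1 + 1))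
    rw [sub_self, h_first, h_second]
    exact h 0 0
  · change H.Less s(zigzag x f g (Fin.last _ - 1), zigzag x f g (Fin.last _))
      s(zigzag x f g (Fin.last _), zigzag x f g (Fin.last _ + 1))
    have h_pred : ((Fin.last ((k + 1) * 2) - 1 : Fin _) : ℕ) = 2 * Fin.last k + 1 := by
      rw [Fin.val_sub_one_of_ne_zero Fin.last_pos'.ne', Fin.val_last, Fin.val_last]; lia
    rw [Fin.last_add_one, h_last, zigzag_two_mul_add_one _ h_pred]
    exact h (Fin.last k) (Fin.last k)

theorem spansMonotoneCycle_zigzag {f g : Fin (k + 1) → W} {i₀ : Fin 3}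
    (hf : f.Injective) (hg : g.Injective) (hfg : ∀ i j, f i ≠ g j)
    (hx : x ∉ Set.range f ∪ Set.range g)
    (hf_less : ∀ l i j, i < j → H.Less s(f i, g l) s(g l, f j))
    (hg_less : ∀ l i j, i < j → H.Less s(g i, f l) s(f l, g j))
    (hx_less : ∀ i ≠ i₀, ∀ a b, H.IncreasesAt ![x, f a, g b] i) :
    H.SpansMonotoneCycle ((k + 1) * 2 + 1) (insert x (Set.range f ∪ Set.range g)) := by
  let pos : Fin 3 → Fin ((k + 1) * 2 + 1) := ![0, 1, Fin.last _]
  rw [← range_interleave] at hx ⊢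
  refine ⟨zigzag x f g, Fin.cons_injective_iff.mpr ⟨hx, interleave_injective hf hg hfg⟩,
    Fin.range_cons _ _, pos i₀, fun i hi => ?_⟩
  by_cases h : i ∈ Set.range pos
  · obtain ⟨j, rfl⟩ := h
    exact increasesAt_zigzag_of_triangle (hx_less j fun hj => hi (congrArg pos hj))
  · have h0 : i ≠ 0 := fun h' => h ⟨0, h'.symm⟩
    have h1 : (i : ℕ) ≠ 1 := fun h' => h ⟨1, Fin.ext h'.symm⟩
    have hl : i ≠ Fin.last _ := fun h' => h ⟨2, h'.symm⟩
    exact increasesAt_zigzag_of_one_lt hf_less hg_less (by have := Fin.val_ne_zero_iff.mpr h0; lia)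
      (Fin.lt_last_iff_ne_last.mpr hl)

end Zigzag

end Cycles

section Uniform

variable {W : Type*} [LinearOrder W] {H : EdgeOrderedGraph W} {A S : Finset W} {x : W} {k : ℕ}

/-- The comparisons of the edges of a triangle formed by `x` and two vertices `a < b` of `A` do not
depend on `a` and `b`. -/
def IsUniformAt (H : EdgeOrderedGraph W) (x : W) (A : Finset W) : Prop :=
  ∃ c : Fin 3 → Prop, ∀ a ∈ A, ∀ b ∈ A, a < b → ∀ i, H.IncreasesAt ![x, a, b] i ↔ c i

/-- The comparisons of the edges of a triangle with vertices `x < a < b` in `A` do not depend on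
the triangle. -/
def IsUniform (H : EdgeOrderedGraph W) (A : Finset W) : Prop :=
  ∃ c : Fin 3 → Prop, ∀ x ∈ A, ∀ a ∈ A, ∀ b ∈ A, x < a → a < b →
    ∀ i, H.IncreasesAt ![x, a, b] i ↔ c i

theorem isUniform_of_isMonochromatic
    (hA : IsMonochromatic (fun u : Fin 3 → W => H.IncreasesAt u) A) : H.IsUniform A := by
  obtain ⟨c, hc⟩ := hA
  refine ⟨c, fun x hx a ha b hb hxa hab i => iff_of_eq (congrFun (hc _ ?_ ?_) i)⟩
  · simp [Fin.strictMono_iff_lt_succ, Fin.forall_fin_succ, hxa, hab]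
  · simp [Fin.forall_fin_succ, *]

theorem isUniformAt_of_isMonochromatic
    (hA : IsMonochromatic (fun u : Fin 2 → W => H.IncreasesAt ![x, u 0, u 1]) A) :
    H.IsUniformAt x A := by
  obtain ⟨c, hc⟩ := hA
  refine ⟨c, fun a ha b hb hab i => iff_of_eq (congrFun (hc ![a, b] ?_ ?_) i)⟩
  · simp [Fin.strictMono_iff_lt_succ, hab]
  · simp [*]

theorem IsUniform.mono (hA : H.IsUniform A) (hSA : S ⊆ A) : H.IsUniform S :=
  hA.imp fun _ hc x hx a ha b hb => hc x (hSA hx) a (hSA ha) b (hSA hb)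

theorem IsUniform.isUniformAt (hA : H.IsUniform A) (hx : x ∈ A) (hSA : S ⊆ A)
    (hxS : ∀ a ∈ S, x < a) : H.IsUniformAt x S :=
  hA.imp fun _ hc a ha b hb => hc x hx a (hSA ha) b (hSA hb) (hxS a ha)

theorem exists_less_enum_of_less_iff (hH : H.graph = ⊤) {L U : Finset W} (hL : #L = k)
    (hLU : Disjoint L U) {c : Prop}
    (hc : ∀ a ∈ L, ∀ b ∈ L, a < b → ∀ u ∈ U, H.Less s(b, u) s(u, a) ↔ c) :
    ∃ f : Fin k → W, f.Injective ∧ Set.range f = L ∧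
      ∀ i j, i < j → ∀ u ∈ U, H.Less s(f i, u) s(u, f j) := by
  refine exists_enum_of_forall_lt (r := fun a b => ∀ u ∈ U, H.Less s(a, u) s(u, b)) hL ?_
  by_cases h : c
  · exact .inr fun a ha b hb hab u hu => (hc a ha b hb hab u hu).mpr h
  · exact .inl fun a ha b hb hab u hu => less_of_not_less hH (disjoint_right.mp hLU hu <| · ▸ hb)
      (disjoint_right.mp hLU hu <| · ▸ ha) hab.ne' fun h' => h ((hc a ha b hb hab u hu).mp h')

theorem IsUniform.exists_lower_upper_enum (hH : H.graph = ⊤) (hA : H.IsUniform A)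
    (hcard : #A = k * 2) :
    ∃ f g : Fin k → W, f.Injective ∧ g.Injective ∧ (∀ i j, f i < g j) ∧
      Set.range f ∪ Set.range g = A ∧ (∀ l i j, i < j → H.Less s(f i, g l) s(g l, f j)) ∧
      ∀ l i j, i < j → H.Less s(g i, f l) s(f l, g j) := by
  obtain ⟨L, U, rfl, hL, hU, hlt⟩ := exists_union_eq_forall_lt (hcard.trans (mul_two _))
  have hLU : Disjoint L U := disjoint_left.mpr fun a haL haU => (hlt a haL a haU).false
  have hLA : ∀ a ∈ L, a ∈ L ∪ U := fun _ => mem_union_left U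
  have hUA : ∀ a ∈ U, a ∈ L ∪ U := fun _ => mem_union_right L
  obtain ⟨c, hc⟩ := hA
  obtain ⟨f, hf, hfL, hf_less⟩ := exists_less_enum_of_less_iff hH hL hLU
    fun a ha b hb hab u hu => hc a (hLA a ha) b (hLA b hb) u (hUA u hu) hab (hlt b hb u hu) 2
  obtain ⟨g, hg, hgU, hg_less⟩ := exists_less_enum_of_less_iff hH hU hLU.symm
    fun a ha b hb hab l hl => hc l (hLA l hl) a (hUA a ha) b (hUA b hb) (hlt l hl a ha) hab 0
  have hfL' : ∀ i, f i ∈ L := fun i => mem_coe.mp (hfL ▸ Set.mem_range_self i)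
  have hgU' : ∀ i, g i ∈ U := fun i => mem_coe.mp (hgU ▸ Set.mem_range_self i)
  exact ⟨f, g, hf, hg, fun i j => hlt _ (hfL' i) _ (hgU' j), by rw [hfL, hgU, coe_union],
    fun l i j hij => hf_less i j hij _ (hgU' l), fun l i j hij => hg_less i j hij _ (hfL' l)⟩

theorem IsUniformAt.spansMonotoneCycle (hH : H.graph = ⊤) (hxA : H.IsUniformAt x A)
    (hx : x ∉ A) (hA : H.IsUniform A) (hcard : #A = (k + 1) * 2) :
    H.SpansMonotoneCycle ((k + 1) * 2 + 1) (insert x A : Finset W) := by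
  obtain ⟨f, g, hf, hg, hfg, hfgA, hf_less, hg_less⟩ := hA.exists_lower_upper_enum hH hcard
  rw [← mem_coe, ← hfgA] at hx
  have hfA : ∀ i, f i ∈ A := fun i => mem_coe.mp (hfgA ▸ .inl (Set.mem_range_self i))
  have hgA : ∀ i, g i ∈ A := fun i => mem_coe.mp (hfgA ▸ .inr (Set.mem_range_self i))
  obtain ⟨c, hc⟩ := hxA
  have hcfg : ∀ a b i, H.IncreasesAt ![x, f a, g b] i ↔ c i := fun a b =>
    hc _ (hfA a) _ (hgA b) (hfg a b)
  rw [coe_insert, ← hfgA]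
  rcases exists_forall_ne_or_exists_forall_ne_not c with ⟨i₀, h⟩ | ⟨i₀, h⟩
  · exact spansMonotoneCycle_zigzag hf hg (fun i j => (hfg i j).ne) hx hf_less hg_less
      fun i hi a b => (hcfg a b i).mpr (h i hi)
  · have swap : ∀ a b, ∀ i ≠ i₀, H.IncreasesAt ![x, g a, f b] (-i) := fun a b i hi =>
      increasesAt_triangle_swap hH (fun h => hx (.inl ⟨b, h.symm⟩)) (fun h => hx (.inr ⟨a, h.symm⟩))
        (hfg b a).ne fun h' => h i hi ((hcfg b a i).mp h')
    rw [Set.union_comm] at hx ⊢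
    exact spansMonotoneCycle_zigzag hg hf (fun i j => (hfg j i).ne') hx hg_less hf_less
      (i₀ := -i₀) fun i hi a b => neg_neg i ▸ swap a b (-i) (fun h => hi (neg_eq_iff_eq_neg.mp h))

theorem IsUniform.spansMonotoneCycle (hH : H.graph = ⊤) (hA : H.IsUniform A)
    (hcard : #A = (k + 1) * 2 + 1) : H.SpansMonotoneCycle ((k + 1) * 2 + 1) (A : Set W) := by
  have hne : A.Nonempty := card_pos.mp (by lia)
  have hx := A.min'_mem hne
  rw [← insert_erase hx]
  exact (hA.isUniformAt hx (erase_subset _ A) fun a => A.min'_lt_of_mem_erase_min' hne)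
    |>.spansMonotoneCycle hH (notMem_erase _ A) (hA.mono (erase_subset _ A))
      (by rw [card_erase_of_mem hx, hcard, Nat.add_sub_cancel])

end Uniform

theorem SpansMonotoneCycle.card_eq {W : Type*} {H : EdgeOrderedGraph W} {n : ℕ} [NeZero n]
    {B : Finset W} (hB : H.SpansMonotoneCycle n (B : Set W)) : #B = n := by
  obtain ⟨c, hc, hcB, -⟩ := hB
  rw [← Set.ncard_coe_finset, ← hcB, Set.ncard_range_of_injective hc, Nat.card_fin]

theorem exists_finpartition_spansMonotoneCycle (k : ℕ) :
    ∃ t, 0 < t ∧ (k + 1) * 2 + 1 ∣ t ∧ ∀ (W : Type u) [Fintype W] [LinearOrder W]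
      (H : EdgeOrderedGraph W), H.graph = ⊤ → Fintype.card W = t →
        ∃ Q : Finpartition (univ : Finset W),
          ∀ B ∈ Q.parts, H.SpansMonotoneCycle ((k + 1) * 2 + 1) (B : Set W) := by
  obtain ⟨N₃, hN₃⟩ := exists_isMonochromatic.{u} (Fin 3 → Prop) 3 ((k + 1) * 2 + 1)
  obtain ⟨N₂, hN₂⟩ := exists_isMonochromatic.{u} (Fin 3 → Prop) 2 ((k + 1) * 2)
  obtain ⟨M, hM⟩ := exists_isMonochromatic.{u} (Fin 3 → Prop) 3 (N₃ * ((k + 1) * 2) + N₂)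
  refine ⟨((k + 1) * 2 + 1) * (M + 1), by positivity, dvd_mul_right .., fun W _ _ H hH hW => ?_⟩
  obtain ⟨A, -, hA, hA'⟩ := hM W univ (by rw [card_univ, hW]; nlinarith) fun u => H.IncreasesAt u
  have hunif := isUniform_of_isMonochromatic hA'
  rw [← sdiff_union_of_subset (subset_univ A)]
  refine exists_finpartition_union (P := fun B => H.SpansMonotoneCycle _ (B : Set W))
    sdiff_disjoint (fun B hB => hB.card_eq)
    (fun B hBA hB => (hunif.mono hBA).spansMonotoneCycle hH hB)
    (fun T _ hT => ?_) (fun x hx T hTA hT => ?_) hA.ge ?_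
  · obtain ⟨B, hBT, hB, hB'⟩ := hN₃ W T hT fun u => H.IncreasesAt u
    exact ⟨B, hBT, (isUniform_of_isMonochromatic hB').spansMonotoneCycle hH hB⟩
  · obtain ⟨B, hBT, hB, hB'⟩ := hN₂ W T hT fun u => H.IncreasesAt ![x, u 0, u 1]
    exact ⟨B, hBT, hB, (isUniformAt_of_isMonochromatic hB').spansMonotoneCycle hH
      (fun hxB => (mem_sdiff.mp hx).2 (hTA (hBT hxB))) (hunif.mono (hBT.trans hTA)) hB⟩
  · rw [sdiff_union_of_subset (subset_univ A), card_univ, hW]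
    exact dvd_mul_right ..

section Embeddings

variable {V W : Type*} {F : EdgeOrderedGraph V} {H : EdgeOrderedGraph W} {n : ℕ}

theorem SpansMonotoneCycle.exists_monotone_enum [NeZero n] {B : Set W}
    (hB : H.SpansMonotoneCycle n B) : ∃ v : Fin n → W, v.Injective ∧ Set.range v = B ∧
      ∀ i j, i < j → H.Less s(v i, v (i + 1)) s(v j, v (j + 1)) := by
  obtain ⟨c, hc, hcB, i₀, hi₀⟩ := hB
  obtain ⟨n, rfl⟩ := Nat.exists_eq_succ_of_ne_zero (NeZero.ne n)
  refine ⟨fun i => c (i + i₀), hc.comp (add_left_injective i₀), ?_, ?_⟩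
  · exact ((Equiv.addRight i₀).surjective.range_comp c).trans hcB
  · refine (Fin.liftFun_iff_succ H.Less).mpr fun i => ?_
    have h := hi₀ (i.succ + i₀) fun h => i.succ_ne_zero (add_eq_right.mp h)
    have hpred : i.castSucc + i₀ = i.succ + i₀ - 1 := by rw [← Fin.coeSucc_eq_succ]; abel
    rw [IncreasesAt, ← hpred, add_right_comm] at h
    rwa [Fin.coeSucc_eq_succ]

theorem exists_eq_of_adj_cycleGraph {i j : Fin n} (h : (SimpleGraph.cycleGraph n).Adj i j) :
    ∃ k, s(i, j) = s(k, finRotate n k) := by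
  match n with
  | 0 => exact i.elim0
  | 1 => exact absurd h SimpleGraph.cycleGraph_one_adj
  | n + 2 =>
    rcases SimpleGraph.cycleGraph_adj.mp h with h | h
    · exact ⟨j, by rw [finRotate_apply, ← h, add_sub_cancel, Sym2.eq_swap]⟩
    · exact ⟨i, by rw [finRotate_apply, ← h, add_sub_cancel]⟩

theorem exists_eq_of_mem_edgeSet {G : SimpleGraph V} (u : SimpleGraph.cycleGraph n ≃g G)
    {e : Sym2 V} (he : e ∈ G.edgeSet) : ∃ i, e = s(u i, u (finRotate n i)) := by
  induction e with
  | h a b =>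
    obtain ⟨i, hi⟩ := exists_eq_of_adj_cycleGraph (u.symm.map_adj_iff.mpr he)
    exact ⟨i, by simpa using congrArg (Sym2.map u) hi⟩

theorem IsMonotoneCycle.exists_embedding [NeZero n] (hF : F.IsMonotoneCycle n) {B : Set W}
    (hB : H.SpansMonotoneCycle n B) : ∃ φ : F.Embedding H, Set.range φ.toHom = B := by
  obtain ⟨v, hv, rfl, hv_less⟩ := hB.exists_monotone_enum
  obtain ⟨hn, u, hu_less⟩ := hF
  have := Fin.nontrivial_iff_two_le.mpr (show 2 ≤ n by lia)
  let q : V → W := v ∘ u.symm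
  have hq : q.Injective := hv.comp u.symm.injective
  have hq_edge : ∀ i, Sym2.map q s(u i, u (finRotate n i)) = s(v i, v (i + 1)) := fun i => by
    simp [q]
  have hq_adj : ∀ {a b}, F.graph.Adj a b → H.graph.Adj (q a) (q b) := fun {a b} hab => by
    obtain ⟨i, hi⟩ := exists_eq_of_mem_edgeSet u (F.graph.mem_edgeSet.mpr hab)
    rw [← SimpleGraph.mem_edgeSet, ← Sym2.map_mk, hi, hq_edge]
    obtain ⟨j, hij⟩ := exists_ne i
    exact hij.lt_or_gt.elim (fun h => (hv_less j i h).2.1) fun h => (hv_less i j h).1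
  refine ⟨⟨⟨⟨q, hq_adj⟩, hq⟩, fun e₁ e₂ h => ?_⟩, u.symm.surjective.range_comp v⟩
  obtain ⟨i, rfl⟩ := exists_eq_of_mem_edgeSet u h.1
  obtain ⟨j, rfl⟩ := exists_eq_of_mem_edgeSet u h.2.1
  have hij : i < j := by
    by_contra! hji
    rcases hji.lt_or_eq with hji | rfl
    · exact Less.irrefl _ (h.trans (hu_less j i hji))
    · exact Less.irrefl _ h
  exact (hq_edge i).symm ▸ (hq_edge j).symm ▸ hv_less i j hij

theorem hasPerfectTiling_of_finpartition [Fintype W] [DecidableEq W]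
    (Q : Finpartition (univ : Finset W))
    (hQ : ∀ B ∈ Q.parts, ∃ φ : F.Embedding H, Set.range φ.toHom = B) : F.HasPerfectTiling H := by
  choose φ hφ using hQ
  refine ⟨Set.range fun B : Q.parts => φ B B.2, ?_, Set.eq_univ_of_forall fun w => ?_⟩
  · rintro _ ⟨B, rfl⟩ _ ⟨C, rfl⟩ hne
    have hBC : (B : Finset W) ≠ C := fun h => hne (by rw [Subtype.ext h])
    rw [Function.onFun, hφ, hφ, disjoint_coe]
    exact Q.disjoint B.2 C.2 hBC
  · obtain ⟨B, hB, hw⟩ := Q.exists_mem (mem_univ w)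
    exact Set.mem_biUnion ⟨⟨B, hB⟩, rfl⟩ (hφ B hB ▸ hw)

end Embeddings

end EdgeOrderedGraph

theorem proposition2p18 {V : Type*} [Fintype V] (F : EdgeOrderedGraph V) (n : ℕ) (hn : Odd n)
    (hF : F.IsMonotoneCycle n) : F.Tileable := by
  obtain ⟨k, rfl⟩ : ∃ k, n = (k + 1) * 2 + 1 := by
    obtain ⟨k, rfl⟩ := hn
    exact ⟨k - 1, by have := hF.1; lia⟩
  obtain ⟨t, ht, hdvd, htiling⟩ := EdgeOrderedGraph.exists_finpartition_spansMonotoneCycle k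
  have ⟨_, u, _⟩ := hF
  refine ⟨t, ht, ?_, fun o => ?_⟩
  · rwa [← Fintype.card_congr u.toEquiv, Fintype.card_fin]
  · obtain ⟨Q, hQ⟩ := htiling (Fin t) ⟨⊤, o⟩ rfl (Fintype.card_fin t)
    exact EdgeOrderedGraph.hasPerfectTiling_of_finpartition Q fun B hB =>
      hF.exists_embedding (hQ B hB)
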